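/- All $C^*$-algebras, $C^*$-subalgebras and $*$-homomorphisms are unital. Let $n\ge 1$ be an integer and let $K>0$ be a real number ($K=1$ gives the bounded rank without further specification). **Classes.** $\mathcal{AP}(n)$ is the class of all $C^*$-algebras $X$ such that for every $a\in X$ with $\|a\|\le 1$ and every $\varepsilon>0$ there is $b\in X$ with $\|b\|\le 1$ and $\|a-b^n\|<\varepsilon$. $\mathcal{HP}(n)$ is defined in the same way, with the condition imposed only on invertible $a\in X$ with $\|a\|\le 1$. $\mathcal{AP}_1(n)$ is the class of those $X\in\mathcal{AP}(n)$ whose bounded rank (with respect to $K$) is at most $1$; here the bounded rank of $X$ with respect to $K$ is at most $d$ if for all $0<K'<K$, all self-adjoint $y_1,\dots,y_{d+1}\in X$ and all $\delta>0$ there are self-adjoint $z_1,\dots,z_{d+1}\in X$ such that $\|y_k-z_k\|\le\delta$ for each $k$, the element $\sum_k z_k^2$ is invertible, and $\bigl\|(\sum_k z_k^2)^{-1}\bigr\|\le \frac{1}{K'\delta^2}$. **Orders.** For a set $Y$, $\exp_\omega Y$ is the set of all countable (possibly finite) subsets of $Y$, ordered by inclusion. A subset $A\subseteq\exp_\omega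 Y$ is cofinal if every element of $\exp_\omega Y$ is contained in an element of $A$, and $\omega$-closed if the supremum in $\exp_\omega Y$ (that is, the union) of every non-empty countable chain in $A$ belongs to $A$. The density $d(X)$ is the least cardinality of a dense subset of $X$. **Systems.** A direct system $\{X_\alpha,i_\alpha^\beta,A\}$ of $C^*$-algebras over a non-empty directed partially ordered set $A$, with limit $X$ (in the category of unital $C^*$-algebras) and limit homomorphisms $i_\alpha\colon X_\alpha\to X$, is a direct $C^*_\omega$-system if: every non-empty countable chain in $A$ has a supremum in $A$; every $X_\alpha$ has density at most $\omega$; every $i_\alpha$ is injective; and for every non-empty countable chain $B\subseteq A$ with supremum $\alpha$, the homomorphism $\varinjlim_{\beta\in B}X_\beta\to X_\alpha$ induced by the $i_\beta^\alpha$, $\beta\in B$, is an isomorphism. **Proposition 3.4.** Let $\mathcal K$ be one of the classes $\mathcal{AP}(n)$, $\mathcal{AP}_1(n)$, $\mathcal{HP}(n)$. For a unital $C^*$-algebra $X$ and a dense subset $Y\subseteq X$, let $D(X,Y)$ be the following assertion: there are a cofinal and $\omega$-closed subset $A$ of $\exp_\omega Y$ and separable unital $C^*$-subalgebras $X_\alpha\subseteq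 X$, $\alpha\in A$, with $X_\alpha\in\mathcal K$ for all $\alpha$ and $X_\alpha\subseteq X_\beta$ whenever $\alpha\subseteq\beta$, which together with the inclusion maps form a direct $C^*_\omega$-system whose limit is $X$, with the inclusions $X_\alpha\hookrightarrow X$ as limit homomorphisms. Then for every unital $C^*$-algebra $X$ the following conditions are equivalent: 1. $X\in\mathcal K$; 2. $D(X,Y)$ holds for some dense subset $Y$ of $X$ with $|Y|=d(X)$; 3. $D(X,Y)$ holds for every dense subset $Y$ of $X$ with $|Y|=d(X)$. -/

import Mathlib

open scoped Cardinal

universe u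

namespace RootProperty

noncomputable section

/-! ### Classes of unital C*-algebras -/

/-- The approximate `n`-th root property: the class `AP(n)`. -/
def IsAP (n : ℕ) (X : Type u) [CStarAlgebra X] : Prop :=
  ∀ a : X, ‖a‖ ≤ 1 → ∀ ε : ℝ, 0 < ε → ∃ b : X, ‖b‖ ≤ 1 ∧ ‖a - b ^ n‖ < ε

/-- The approximate `n`-th root property for invertible elements: the class `HP(n)`. -/
def IsHP (n : ℕ) (X : Type u) [CStarAlgebra X] : Prop :=
  ∀ a : X, IsUnit a → ‖a‖ ≤ 1 → ∀ ε : ℝ, 0 < ε → ∃ b : X, ‖b‖ ≤ 1 ∧ ‖a - b ^ n‖ < ε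

/-- A tuple `y` of self-adjoint elements is `K`-unessential if for every `δ > 0` there is a tuple
`z` of self-adjoint elements with `‖y k - z k‖ ≤ δ` for all `k`, such that `∑ (z k)²` is
invertible and its inverse has norm at most `1 / (K δ²)`. -/
def IsUnessential (K : ℝ) {X : Type u} [CStarAlgebra X] {m : ℕ} (y : Fin m → X) : Prop :=
  ∀ δ : ℝ, 0 < δ → ∃ z : Fin m → X,
    (∀ k, IsSelfAdjoint (z k)) ∧ (∀ k, ‖y k - z k‖ ≤ δ) ∧
    ∃ v : Xˣ, (v : X) = ∑ k, z k ^ 2 ∧ ‖((v⁻¹ : Xˣ) : X)‖ ≤ 1 / (K * δ ^ 2)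

/-- The bounded rank of `X` with respect to `K` is at most `d`: every `(d + 1)`-tuple of
self-adjoint elements is unessential for every constant below `K`. -/
def BoundedRankLE (K : ℝ) (d : ℕ) (X : Type u) [CStarAlgebra X] : Prop :=
  ∀ K' : ℝ, 0 < K' → K' < K → ∀ y : Fin (d + 1) → X,
    (∀ k, IsSelfAdjoint (y k)) → IsUnessential K' y

/-- Names for the three classes of C*-algebras under consideration. -/
inductive RootClass
  | AP
  | AP₁
  | HP

/-- `𝒦.Mem K n X`: the unital C*-algebra `X` belongs to the class `𝒦` for the exponent `n`.
The constant `K` is used only by `AP₁`, as the constant of the bounded rank. -/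
def RootClass.Mem (𝒦 : RootClass) (K : ℝ) (n : ℕ) (X : Type u) [CStarAlgebra X] : Prop :=
  match 𝒦 with
  | .AP => IsAP n X
  | .AP₁ => IsAP n X ∧ BoundedRankLE K 1 X
  | .HP => IsHP n X

/-! ### Density, and the ordered sets `exp_τ Y` -/

/-- The density `d(X)` of a topological space: the least cardinality of a dense subset. -/
def density (X : Type u) [TopologicalSpace X] : Cardinal.{u} :=
  sInf {c | ∃ s : Set X, Dense s ∧ #s = c}

/-- `exp_τ Y`: the subsets of `Y` of cardinality at most `τ`, ordered by inclusion. -/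
abbrev Exp (τ : Cardinal.{u}) (Y : Type u) : Type u :=
  {s : Set Y // #s ≤ τ}

/-- A partially ordered set is `τ`-complete if each nonempty chain of cardinality at most `τ`
has a supremum in it. -/
def IsTauComplete (τ : Cardinal.{u}) (A : Type u) [PartialOrder A] : Prop :=
  ∀ C : Set A, C.Nonempty → IsChain (· ≤ ·) C → #C ≤ τ → ∃ s, IsLUB C s

/-- A subset `A` of a partially ordered set `P` is `τ`-closed if each nonempty chain
in `A` of cardinality at most `τ` has its supremum, taken in `P`, in `A`. -/
def IsTauClosed (τ : Cardinal.{u}) {P : Type u} [PartialOrder P] (A : Set P) : Prop :=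
  ∀ C : Set P, C ⊆ A → C.Nonempty → IsChain (· ≤ ·) C → #C ≤ τ → ∃ s ∈ A, IsLUB C s

/-! ### Direct systems of unital C*-algebras and their limits -/

/-- A direct system of unital C*-algebras and unital `*`-homomorphisms over `A`. -/
structure DirectSystem (A : Type u) [PartialOrder A] where
  /-- The algebra at an index. -/
  obj : A → Type u
  [inst : ∀ α, CStarAlgebra (obj α)]
  /-- The connecting homomorphisms. -/
  map : ∀ {α β : A}, α ≤ β → (obj α →⋆ₐ[ℂ] obj β)
  map_refl : ∀ α, map (le_refl α) = StarAlgHom.id ℂ (obj α)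
  map_comp : ∀ {α β γ : A} (h₁ : α ≤ β) (h₂ : β ≤ γ),
    map (h₁.trans h₂) = (map h₂).comp (map h₁)

attribute [instance] DirectSystem.inst

namespace DirectSystem

variable {A : Type u} [PartialOrder A]

/-- The subsystem over a subset of the index set. -/
def restrict (D : DirectSystem A) (B : Set A) : DirectSystem B where
  obj β := D.obj β
  map h := D.map h
  map_refl β := D.map_refl β
  map_comp h₁ h₂ := D.map_comp h₁ h₂

/-- The unital C*-algebra `L` with the homomorphisms `i α` is the direct limit of `D`, in the
category of unital C*-algebras. -/
structure IsLimit (D : DirectSystem A) (L : Type u) [CStarAlgebra L]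
    (i : ∀ α, D.obj α →⋆ₐ[ℂ] L) : Prop where
  compat : ∀ {α β : A} (h : α ≤ β), (i β).comp (D.map h) = i α
  universal : ∀ (Z : Type u) [CStarAlgebra Z] (f : ∀ α, D.obj α →⋆ₐ[ℂ] Z),
    (∀ {α β : A} (h : α ≤ β), (f β).comp (D.map h) = f α) →
    ∃! g : L →⋆ₐ[ℂ] Z, ∀ α, g.comp (i α) = f α

/-- `D` is a direct `C*_τ`-system with limit `L` and limit homomorphisms `i α`.
The last field says that, for a chain `B` of at most `τ` indices with supremum `α`, the
homomorphism from the limit of the subsystem over `B` to `D.obj α` induced by the connecting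
homomorphisms is an isomorphism. -/
structure IsCStarTauSystem (τ : Cardinal.{u}) (D : DirectSystem A) (L : Type u) [CStarAlgebra L]
    (i : ∀ α, D.obj α →⋆ₐ[ℂ] L) : Prop where
  nonempty : Nonempty A
  directed : IsDirected A (· ≤ ·)
  isLimit : D.IsLimit L i
  complete : IsTauComplete τ A
  density_le : ∀ α, density (D.obj α) ≤ τ
  injective : ∀ α, Function.Injective (i α)
  continuous : ∀ (B : Set A), B.Nonempty → IsChain (· ≤ ·) B → #B ≤ τ →
    ∀ (α : A) (hα : IsLUB B α),
      (D.restrict B).IsLimit (D.obj α) (fun β => D.map (hα.1 β.2))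

end DirectSystem

/-! ### Systems of C*-subalgebras -/

/-- A unital C*-subalgebra of `X`: a norm-closed unital `*`-subalgebra. -/
structure CStarSubalgebra (X : Type u) [CStarAlgebra X] where
  /-- The underlying unital `*`-subalgebra. -/
  toStarSubalgebra : StarSubalgebra ℂ X
  isClosed : IsClosed (toStarSubalgebra : Set X)

/-- The underlying type of a C*-subalgebra. -/
abbrev CStarSubalgebra.carrier {X : Type u} [CStarAlgebra X] (S : CStarSubalgebra X) : Type u :=
  S.toStarSubalgebra

instance {X : Type u} [CStarAlgebra X] (S : CStarSubalgebra X) : CStarAlgebra S.carrier :=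
  StarSubalgebra.cstarAlgebra S.toStarSubalgebra (h_closed := S.isClosed)

/-- The direct system of C*-subalgebras of `X` and inclusions given by an increasing family. -/
def subalgebraSystem {X : Type u} [CStarAlgebra X] {A : Type u} [PartialOrder A]
    (S : A → CStarSubalgebra X)
    (hS : ∀ α β, α ≤ β → (S α).toStarSubalgebra ≤ (S β).toStarSubalgebra) :
    DirectSystem A where
  obj α := (S α).carrier
  map {α β} h := StarSubalgebra.inclusion (hS α β h)
  map_refl _ := rfl
  map_comp _ _ := rfl

/-- `X` is the direct limit of a direct `C*_ω`-system of separable C*-subalgebras of `X` having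
the property `P`, with inclusions as connecting and limit homomorphisms, indexed by a cofinal
and `ω`-closed subset of `exp_ω Y`. -/
def HasDecomposition (P : ∀ (Z : Type u) [CStarAlgebra Z], Prop)
    (X : Type u) [CStarAlgebra X] (Y : Set X) : Prop :=
  ∃ A : Set (Exp ℵ₀ Y), IsCofinal A ∧ IsTauClosed ℵ₀ A ∧
    ∃ (S : A → CStarSubalgebra X)
      (hS : ∀ α β, α ≤ β → (S α).toStarSubalgebra ≤ (S β).toStarSubalgebra),
      (subalgebraSystem S hS).IsCStarTauSystem ℵ₀ X (fun α => (S α).toStarSubalgebra.subtype) ∧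
      ∀ α, TopologicalSpace.SeparableSpace (S α).carrier ∧ P (S α).carrier

end

end RootProperty

/-!
The three classes are determined by separable data. If `X` is in the class, choose for each pair
`a, b` of elements of `X` a countable set `W a b` of witnesses: approximate `n`-th roots, and, for
the bounded rank, perturbations of pairs together with the inverses of the sums of their squares.
A C*-subalgebra whose pairs of elements can be approximated by pairs with witnesses inside the
subalgebra is again in the class (`RootClass.exists_mem_witnesses`): all the conditions tolerate
small errors, the bounded rank because only constants `K' < K` are required.

Given a dense set `Y`, every witness is a limit of elements of a countable subset of `Y`, and the
C*-subalgebra generated by a finite subset of `Y` has a countable dense subset. Hence there is a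
table `H` sending finite subsets of `Y` to countable ones such that every countable `α ⊆ Y` closed
under `H` generates a subalgebra with the above property (`exists_closedSets_isSaturated`). The
closed sets are cofinal and `ω`-closed for set-theoretic reasons (`isCofinal_closedSets`,
`isTauClosed_closedSets`). The subalgebra generated by a directed union is the closure of the union
of the generated subalgebras, and a C*-algebra containing a directed family of C*-subalgebras with
dense union is their limit (`DirectSystem.isLimit_of_isometry`), so the subalgebras form a direct
`C*_ω`-system (`isCStarTauSystem_generatedBy`).

Conversely, the members of a direct `C*_ω`-system of subalgebras cover the limit
(`DirectSystem.IsCStarTauSystem.exists_mem`), so any two elements of the limit lie in a common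
member. Each of the conditions concerns at most two elements at a time (for `HP(n)` an element and
its inverse), so it passes to the limit (`RootClass.mem_of_forall_mem_mem`).
-/

namespace RootProperty

open scoped CStarAlgebra

/-! ### Closing-off in `exp_ω Y` -/

theorem countable_setOf_finset_subset {Y : Type u} {s : Set Y} (hs : s.Countable) :
    {F : Finset Y | (F : Set Y) ⊆ s}.Countable :=
  ((Set.countable_ofPred_finite_subset hs).preimage Finset.coe_injective).mono
    fun F hF => And.intro F.finite_toSet hF

/-- The union of countably many countable sets, as an element of `exp_ω Y`. -/
def chainUnion {Y : Type u} (C : Set (Exp ℵ₀ Y)) (hC : #C ≤ ℵ₀) : Exp ℵ₀ Y :=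
  ⟨⋃ α : C, α.1.1, by
    have : Countable C := Cardinal.mk_le_aleph0_iff.1 hC
    exact (Set.countable_iUnion fun α => Cardinal.le_aleph0_iff_set_countable.1 α.1.2).le_aleph0⟩

theorem isLUB_chainUnion {Y : Type u} (C : Set (Exp ℵ₀ Y)) (hC : #C ≤ ℵ₀) :
    IsLUB C (chainUnion C hC) :=
  ⟨fun α hα => Set.subset_iUnion (fun β : C => β.1.1) ⟨α, hα⟩,
    fun _ hβ => Set.iUnion_subset fun α => hβ α.2⟩

/-- The countable subsets of `Y` that contain `H F` for each of their finite subsets `F`. -/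
def closedSets {Y : Type u} (H : Finset Y → Set Y) : Set (Exp ℵ₀ Y) :=
  {α | ∀ F : Finset Y, (F : Set Y) ⊆ α.1 → H F ⊆ α.1}

theorem chainUnion_mem_closedSets {Y : Type u} {H : Finset Y → Set Y} {C : Set (Exp ℵ₀ Y)}
    (hCA : C ⊆ closedSets H) (hne : C.Nonempty) (hchain : IsChain (· ≤ ·) C) (hC : #C ≤ ℵ₀) :
    chainUnion C hC ∈ closedSets H := by
  intro F hF
  have := hne.to_subtype
  obtain ⟨α, hα⟩ := Directed.exists_mem_subset_of_finset_subset_biUnion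
    (f := fun α : C => α.1.1) hchain.directed hF
  exact (hCA α.2 F hα).trans (Set.subset_iUnion (fun β : C => β.1.1) α)

theorem isTauClosed_closedSets {Y : Type u} (H : Finset Y → Set Y) :
    IsTauClosed ℵ₀ (closedSets H) := fun C hCA hne hchain hC =>
  ⟨chainUnion C hC, chainUnion_mem_closedSets hCA hne hchain hC, isLUB_chainUnion C hC⟩

/-- Iterating `s ↦ s ∪ ⋃ F ⊆ s, H F` countably often keeps a set countable and makes it closed
under `H`. -/
theorem isCofinal_closedSets {Y : Type u} (H : Finset Y → Set Y) (hH : ∀ F, (H F).Countable) :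
    IsCofinal (closedSets H) := by
  intro α
  let step : Set Y → Set Y := fun s => s ∪ ⋃ F ∈ {F : Finset Y | (F : Set Y) ⊆ s}, H F
  let s : ℕ → Set Y := fun k => step^[k] α.1
  have s_succ : ∀ k, s (k + 1) = step (s k) := fun k => Function.iterate_succ_apply' _ _ _
  have s_mono : Monotone s := monotone_nat_of_le_succ fun k => by
    rw [s_succ]; exact Set.subset_union_left
  have s_countable : ∀ k, (s k).Countable := by
    intro k
    induction k with
    | zero => exact Cardinal.le_aleph0_iff_set_countable.1 α.2
    | succ k ih =>
      rw [s_succ]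
      exact ih.union ((countable_setOf_finset_subset ih).biUnion fun F _ => hH F)
  refine ⟨⟨⋃ k, s k, (Set.countable_iUnion s_countable).le_aleph0⟩, ?_,
    Set.subset_iUnion s 0⟩
  intro F hF
  obtain ⟨k, hk⟩ := s_mono.directed_le.exists_mem_subset_of_finset_subset_biUnion hF
  refine Set.Subset.trans ?_ (Set.subset_iUnion s (k + 1))
  rw [s_succ]
  exact (Set.subset_biUnion_of_mem (u := H) hk).trans Set.subset_union_right

/-! ### Closed subalgebras generated by sets -/

variable {X : Type u} [CStarAlgebra X]

/-- The C*-subalgebra generated by a set. -/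
def generated (s : Set X) : CStarSubalgebra X where
  toStarSubalgebra := (StarAlgebra.adjoin ℂ s).topologicalClosure
  isClosed := StarSubalgebra.isClosed_topologicalClosure _

theorem subset_generated (s : Set X) : s ⊆ (generated s).toStarSubalgebra :=
  (StarAlgebra.subset_adjoin ℂ s).trans (StarSubalgebra.le_topologicalClosure _)

theorem generated_mono {s t : Set X} (h : s ⊆ t) :
    (generated s).toStarSubalgebra ≤ (generated t).toStarSubalgebra :=
  StarSubalgebra.topologicalClosure_mono (StarAlgebra.adjoin_mono h)

/-- The linear span of the countable submonoid generated by `s ∪ star s` is dense. -/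
theorem isSeparable_generated {s : Set X} (hs : s.Countable) :
    TopologicalSpace.IsSeparable ((generated s).toStarSubalgebra : Set X) := by
  have hstar : (star s).Countable := by
    rw [← Set.image_star]; exact hs.image _
  have hcount : ((Submonoid.closure (s ∪ star s) : Submonoid X) : Set X).Countable := by
    have : Countable ↥(s ∪ star s) := (hs.union hstar).to_subtype
    rw [Submonoid.closure_eq_mrange]
    exact Set.countable_range _
  have h := hcount.isSeparable.span (R := ℂ)
  rw [← Algebra.adjoin_eq_span] at h
  exact h.closure

theorem exists_mem_generated_of_directed {ι : Type*} [Nonempty ι] {s : ι → Set X}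
    (hs : Directed (· ⊆ ·) s) {x : X} (hx : x ∈ (generated (⋃ i, s i)).toStarSubalgebra)
    {ε : ℝ} (hε : 0 < ε) : ∃ i, ∃ y ∈ (generated (s i)).toStarSubalgebra, ‖x - y‖ < ε := by
  have hdir : Directed (· ≤ ·) fun i => (generated (s i)).toStarSubalgebra :=
    hs.mono_comp _ (g := fun t => (generated t).toStarSubalgebra) fun _ _ h => generated_mono h
  have hle : StarAlgebra.adjoin ℂ (⋃ i, s i) ≤ ⨆ i, (generated (s i)).toStarSubalgebra :=
    StarAlgebra.adjoin_le (Set.iUnion_subset fun i =>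
      (subset_generated (s i)).trans (le_iSup (fun i => (generated (s i)).toStarSubalgebra) i))
  have hx' : x ∈ closure ((⨆ i, (generated (s i)).toStarSubalgebra : StarSubalgebra ℂ X) : Set X) :=
    StarSubalgebra.topologicalClosure_mono hle hx
  obtain ⟨y, hy, hxy⟩ := Metric.mem_closure_iff.1 hx' ε hε
  rw [StarSubalgebra.coe_iSup_of_directed hdir, Set.mem_iUnion] at hy
  obtain ⟨i, hi⟩ := hy
  exact ⟨i, y, hi, by rwa [← dist_eq_norm]⟩

theorem density_le_of_separableSpace (Z : Type u) [TopologicalSpace Z]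
    [TopologicalSpace.SeparableSpace Z] : density Z ≤ ℵ₀ := by
  obtain ⟨s, hs, hd⟩ := TopologicalSpace.exists_countable_dense Z
  have hmem : #s ∈ {c | ∃ s : Set Z, Dense s ∧ #s = c} := ⟨s, hd, rfl⟩
  exact (csInf_le' hmem).trans hs.le_aleph0

theorem exists_dense_mk_eq_density (Z : Type u) [TopologicalSpace Z] :
    ∃ s : Set Z, Dense s ∧ #s = density Z :=
  csInf_mem (s := {c | ∃ s : Set Z, Dense s ∧ #s = c}) ⟨_, Set.univ, dense_univ, rfl⟩

/-! ### Recognizing limits -/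

/-- The C*-algebra `L` is the limit of a directed system of C*-algebras mapped isometrically and
compatibly into `L` with dense union of images. The homomorphism induced by a cocone `f` is read off
the closure of the union of the graphs `{(i α x, f α x)}` in `L × Z`: it is a `*`-subalgebra on which
the second coordinate is dominated by the first, so it is the graph of a function, and its
projection to `L` has closed and dense range. -/
theorem DirectSystem.isLimit_of_isometry {A : Type u} [PartialOrder A] [Nonempty A]
    (D : DirectSystem A) (hA : IsDirected A (· ≤ ·)) (L : Type u) [CStarAlgebra L]
    (i : ∀ α, D.obj α →⋆ₐ[ℂ] L) (compat : ∀ {α β : A} (h : α ≤ β), (i β).comp (D.map h) = i α)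
    (isom : ∀ α x, ‖i α x‖ = ‖x‖)
    (dense : ∀ x : L, ∀ ε : ℝ, 0 < ε → ∃ α, ∃ y, ‖x - i α y‖ < ε) : D.IsLimit L i where
  compat := compat
  universal Z _ f hf := by
    let G₀ : A → StarSubalgebra ℂ (L × Z) := fun α => ((i α).prod (f α)).range
    have hdir : Directed (· ≤ ·) G₀ := by
      refine directed_of_isDirected_le fun α β h => ?_
      rintro _ ⟨x, rfl⟩
      refine ⟨D.map h x, ?_⟩
      exact Prod.ext (DFunLike.congr_fun (compat h) x) (DFunLike.congr_fun (hf h) x)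
    let G : StarSubalgebra ℂ (L × Z) := (⨆ α, G₀ α).topologicalClosure
    have mem_G : ∀ α x, (i α x, f α x) ∈ G := fun α x =>
      StarSubalgebra.le_topologicalClosure _ (le_iSup G₀ α ⟨x, rfl⟩)
    have bound : ∀ p ∈ G, ‖p.2‖ ≤ ‖p.1‖ := by
      refine fun p hp => closure_minimal (t := {p : L × Z | ‖p.2‖ ≤ ‖p.1‖}) ?_
        (isClosed_le (by fun_prop) (by fun_prop)) hp
      rw [StarSubalgebra.coe_iSup_of_directed hdir]
      refine Set.iUnion_subset fun α => ?_
      rintro _ ⟨x, rfl⟩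
      exact (NonUnitalStarAlgHom.norm_apply_le (f α) x).trans_eq (isom α x).symm
    have : CompleteSpace G := (StarSubalgebra.isClosed_topologicalClosure _).completeSpace_coe
    let π : G →⋆ₐ[ℂ] L := (StarAlgHom.fst ℂ L Z).comp G.subtype
    have π_isom : Isometry π := by
      refine AddMonoidHomClass.isometry_of_norm π fun p => ?_
      exact (max_eq_left (bound p.1 p.2)).symm
    have π_surj : Function.Surjective π := by
      intro x
      have hx : x ∈ closure (Set.range π) := by
        refine Metric.mem_closure_iff.2 fun ε hε => ?_
        obtain ⟨α, y, hy⟩ := dense x ε hε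
        exact ⟨i α y, ⟨⟨_, mem_G α y⟩, rfl⟩, by rwa [dist_eq_norm]⟩
      rwa [π_isom.isClosedEmbedding.isClosed_range.closure_eq] at hx
    let e : G ≃⋆ₐ[ℂ] L := StarAlgEquiv.ofBijective π ⟨π_isom.injective, π_surj⟩
    obtain ⟨k, hk⟩ : ∃ k : L →⋆ₐ[ℂ] Z, ∀ α x, k (i α x) = f α x := by
      refine ⟨((StarAlgHom.snd ℂ L Z).comp G.subtype).comp (e.symm : L →⋆ₐ[ℂ] G), fun α x => ?_⟩
      have : e.symm (i α x) = ⟨_, mem_G α x⟩ := e.symm_apply_eq.2 rfl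
      exact congrArg (fun p : G => p.1.2) this
    refine ⟨k, fun α => StarAlgHom.ext (hk α), fun g hg => ?_⟩
    have hdense : Dense (⋃ α, Set.range (i α)) := fun x => by
      refine Metric.mem_closure_iff.2 fun ε hε => ?_
      obtain ⟨α, y, hy⟩ := dense x ε hε
      exact ⟨i α y, Set.mem_iUnion.2 ⟨α, y, rfl⟩, by rwa [dist_eq_norm]⟩
    refine DFunLike.coe_injective (Continuous.ext_on hdense (map_continuous g)
      (map_continuous k) ?_)
    intro x hx
    obtain ⟨α, y, rfl⟩ := Set.mem_iUnion.1 hx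
    rw [hk]
    exact DFunLike.congr_fun (hg α) y

/-! ### Decompositions into saturated subalgebras -/

/-- A subset `S` of `X` is saturated for a table of witnesses `W` if any two of its elements are
approximated by elements `a`, `b` of `X` whose witnesses `W a b` lie in `S`. -/
def IsSaturated (W : X → X → Set X) (S : Set X) : Prop :=
  ∀ x ∈ S, ∀ y ∈ S, ∀ ε : ℝ, 0 < ε → ∃ a b, ‖x - a‖ < ε ∧ ‖y - b‖ < ε ∧ W a b ⊆ S

theorem IsSaturated.mono {V W : X → X → Set X} {S : Set X} (h : IsSaturated W S)
    (hVW : ∀ a b, V a b ⊆ W a b) : IsSaturated V S := fun x hx y hy ε hε =>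
  let ⟨a, b, ha, hb, hab⟩ := h x hx y hy ε hε
  ⟨a, b, ha, hb, (hVW a b).trans hab⟩

/-- The C*-subalgebra of `X` generated by a set of elements of `Y ⊆ X`. -/
noncomputable def generatedBy {Y : Set X} (s : Set Y) : CStarSubalgebra X :=
  generated (Subtype.val '' s)

theorem generatedBy_mono {Y : Set X} {s t : Set Y} (h : s ⊆ t) :
    (generatedBy s).toStarSubalgebra ≤ (generatedBy t).toStarSubalgebra :=
  generated_mono (Set.image_mono h)

theorem exists_mem_generatedBy_of_directed {Y : Set X} {ι : Type*} [Nonempty ι] {s : ι → Set Y}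
    (hs : Directed (· ⊆ ·) s) {x : X} (hx : x ∈ (generatedBy (⋃ i, s i)).toStarSubalgebra)
    {ε : ℝ} (hε : 0 < ε) : ∃ i, ∃ y ∈ (generatedBy (s i)).toStarSubalgebra, ‖x - y‖ < ε := by
  rw [generatedBy, Set.image_iUnion] at hx
  exact exists_mem_generated_of_directed (s := fun i => Subtype.val '' s i)
    (fun i j => let ⟨k, hi, hj⟩ := hs i j; ⟨k, Set.image_mono hi, Set.image_mono hj⟩) hx hε

/-- A set is the directed union of its finite subsets. -/
theorem exists_finset_mem_generatedBy {Y : Set X} {s : Set Y} {x : X}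
    (hx : x ∈ (generatedBy s).toStarSubalgebra) {ε : ℝ} (hε : 0 < ε) :
    ∃ F : Finset Y, (F : Set Y) ⊆ s ∧ ∃ y ∈ (generatedBy (F : Set Y)).toStarSubalgebra,
      ‖x - y‖ < ε := by
  classical
  let f : {F : Finset Y // (F : Set Y) ⊆ s} → Set Y := fun F => (F.1 : Set Y)
  have : Nonempty {F : Finset Y // (F : Set Y) ⊆ s} := ⟨⟨∅, by simp⟩⟩
  have hf : Directed (· ⊆ ·) f := fun F G =>
    ⟨⟨F.1 ∪ G.1, by simpa using ⟨F.2, G.2⟩⟩, by simp [f], by simp [f]⟩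
  have hs : s = ⋃ F, f F := by
    refine Set.Subset.antisymm (fun y hy => ?_) (Set.iUnion_subset fun F => F.2)
    exact Set.mem_iUnion.2 ⟨⟨{y}, by simpa using hy⟩, by simp [f]⟩
  rw [hs] at hx
  obtain ⟨F, hF⟩ := exists_mem_generatedBy_of_directed hf hx hε
  exact ⟨F.1, F.2, hF⟩

/-- For a dense set `Y`, a closing-off table `H` on the finite subsets of `Y` such that every set
closed under `H` generates a saturated subalgebra. -/
theorem exists_closedSets_isSaturated (W : X → X → Set X) (hW : ∀ a b, (W a b).Countable)
    {Y : Set X} (hY : Dense Y) : ∃ H : Finset Y → Set Y, (∀ F, (H F).Countable) ∧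
      ∀ α ∈ closedSets H, IsSaturated W (generatedBy α.1).toStarSubalgebra := by
  classical
  have hT : ∀ w : X, ∃ t : Set Y, t.Countable ∧ w ∈ (generatedBy t).toStarSubalgebra := by
    intro w
    obtain ⟨v, hv, hlim⟩ := mem_closure_iff_seq_limit.1 (hY w)
    refine ⟨Set.range fun k => ⟨v k, hv k⟩, Set.countable_range _, ?_⟩
    refine (generatedBy _).isClosed.mem_of_tendsto hlim (Filter.Eventually.of_forall fun k => ?_)
    exact subset_generated _ ⟨⟨v k, hv k⟩, ⟨k, rfl⟩, rfl⟩
  choose T T_countable mem_T using hT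
  -- `D F` is a countable dense subset of the subalgebra generated by `F`.
  have hD : ∀ F : Finset Y, ∃ d : Set X, d.Countable ∧
      ((generatedBy (F : Set Y)).toStarSubalgebra : Set X) ⊆ closure d := fun F =>
    isSeparable_generated (F.countable_toSet.image _)
  choose D D_countable D_dense using hD
  refine ⟨fun F => ⋃ a ∈ D F, ⋃ b ∈ D F, ⋃ w ∈ W a b, T w, fun F => ?_, ?_⟩
  · exact (D_countable F).biUnion fun a _ => (D_countable F).biUnion fun b _ =>
      (hW a b).biUnion fun w _ => T_countable w
  intro α hα x hx y hy ε hε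
  obtain ⟨F, hF, x', hx', hxx'⟩ := exists_finset_mem_generatedBy hx (half_pos hε)
  obtain ⟨G, hG, y', hy', hyy'⟩ := exists_finset_mem_generatedBy hy (half_pos hε)
  have hFG : ((F ∪ G : Finset Y) : Set Y) ⊆ α.1 := by
    rw [Finset.coe_union]; exact Set.union_subset hF hG
  obtain ⟨a, ha, hxa⟩ := Metric.mem_closure_iff.1 (D_dense (F ∪ G)
    (generatedBy_mono (by simp) hx')) _ (half_pos hε)
  obtain ⟨b, hb, hyb⟩ := Metric.mem_closure_iff.1 (D_dense (F ∪ G)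
    (generatedBy_mono (by simp) hy')) _ (half_pos hε)
  rw [dist_eq_norm] at hxa hyb
  refine ⟨a, b, ?_, ?_, fun w hw => generatedBy_mono ?_ (mem_T w)⟩
  · linarith [norm_sub_le_norm_sub_add_norm_sub x x' a]
  · linarith [norm_sub_le_norm_sub_add_norm_sub y y' b]
  · refine Set.Subset.trans ?_ (hα (F ∪ G) hFG)
    intro t ht
    simp only [Set.mem_iUnion]
    exact ⟨a, ha, b, hb, w, hw, ht⟩

theorem isLimit_subalgebraSystem {A : Type u} [PartialOrder A] [Nonempty A]
    (S : A → CStarSubalgebra X)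
    (hS : ∀ α β, α ≤ β → (S α).toStarSubalgebra ≤ (S β).toStarSubalgebra)
    (hA : IsDirected A (· ≤ ·))
    (dense : ∀ x : X, ∀ ε : ℝ, 0 < ε → ∃ α, ∃ y ∈ (S α).toStarSubalgebra, ‖x - y‖ < ε) :
    (subalgebraSystem S hS).IsLimit X fun α => (S α).toStarSubalgebra.subtype := by
  refine DirectSystem.isLimit_of_isometry _ hA _ _ (fun _ => rfl) (fun _ _ => rfl) ?_
  intro x ε hε
  obtain ⟨α, y, hy, hxy⟩ := dense x ε hε
  exact ⟨α, ⟨y, hy⟩, hxy⟩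

theorem isLimit_restrict_subalgebraSystem {A : Type u} [PartialOrder A]
    (S : A → CStarSubalgebra X)
    (hS : ∀ α β, α ≤ β → (S α).toStarSubalgebra ≤ (S β).toStarSubalgebra)
    (B : Set A) [Nonempty B] (hB : IsChain (· ≤ ·) B) (α : A) (hα : ∀ β : B, β.1 ≤ α)
    (dense : ∀ x ∈ (S α).toStarSubalgebra, ∀ ε : ℝ, 0 < ε →
      ∃ β : B, ∃ y ∈ (S β).toStarSubalgebra, ‖x - y‖ < ε) :
    ((subalgebraSystem S hS).restrict B).IsLimit ((subalgebraSystem S hS).obj α)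
      fun β => (subalgebraSystem S hS).map (hα β) := by
  have hdir : Directed (· ≤ ·) (Subtype.val : B → A) := hB.directed
  refine DirectSystem.isLimit_of_isometry _ ⟨hdir⟩ _ _ (fun _ => rfl) (fun _ _ => rfl) ?_
  intro x ε hε
  obtain ⟨β, y, hy, hxy⟩ := dense x.1 x.2 ε hε
  exact ⟨β, ⟨y, hy⟩, hxy⟩

theorem isCStarTauSystem_generatedBy {Y : Set X} (hY : Dense Y) (H : Finset Y → Set Y)
    (hH : ∀ F, (H F).Countable) :
    (subalgebraSystem (fun α : closedSets H => generatedBy α.1.1)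
      fun _ _ h => generatedBy_mono h).IsCStarTauSystem ℵ₀ X
      fun α => (generatedBy α.1.1).toStarSubalgebra.subtype := by
  have hcof := isCofinal_closedSets H hH
  have hne : Nonempty (closedSets H) :=
    let ⟨α, hα, _⟩ := hcof ⟨∅, by simp⟩
    ⟨⟨α, hα⟩⟩
  have hdir : IsDirected (closedSets H) (· ≤ ·) := by
    refine ⟨fun α β => ?_⟩
    obtain ⟨γ, hγ, hle⟩ := hcof ⟨α.1.1 ∪ β.1.1, ((Cardinal.le_aleph0_iff_set_countable.1
      α.1.2).union (Cardinal.le_aleph0_iff_set_countable.1 β.1.2)).le_aleph0⟩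
    exact ⟨⟨γ, hγ⟩, Set.subset_union_left.trans hle, Set.subset_union_right.trans hle⟩
  -- The supremum in `closedSets H` of a countable chain is its union.
  have hsup : ∀ C : Set (closedSets H), C.Nonempty → IsChain (· ≤ ·) C → #C ≤ ℵ₀ →
      ∃ s : closedSets H, s.1.1 = ⋃ α : C, α.1.1.1 ∧ IsLUB C s := by
    intro C hC hchain hcard
    have hcard' : #(Subtype.val '' C : Set (Exp ℵ₀ Y)) ≤ ℵ₀ := Cardinal.mk_image_le.trans hcard
    have hmem := chainUnion_mem_closedSets (H := H) (C := Subtype.val '' C)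
      (by rintro _ ⟨α, _, rfl⟩; exact α.2) (hC.image _)
      (by
        rintro _ ⟨α, hα, rfl⟩ _ ⟨β, hβ, rfl⟩ hne
        exact hchain hα hβ fun h => hne (congrArg _ h)) hcard'
    refine ⟨⟨_, hmem⟩, ?_, fun α hα => ?_, fun β hβ => ?_⟩
    · change ⋃ α : (Subtype.val '' C : Set (Exp ℵ₀ Y)), α.1.1 = _
      ext y
      simp
    · exact (isLUB_chainUnion _ hcard').1 ⟨α, hα, rfl⟩
    · refine (isLUB_chainUnion _ hcard').2 ?_
      rintro _ ⟨α, hα, rfl⟩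
      exact hβ hα
  refine ⟨hne, hdir, ?_, ?_, ?_, ?_, ?_⟩
  · refine isLimit_subalgebraSystem _ _ hdir fun x ε hε => ?_
    obtain ⟨y, hy, hxy⟩ := Metric.mem_closure_iff.1 (hY x) ε hε
    obtain ⟨α, hα, hle⟩ := hcof ⟨{⟨y, hy⟩}, by simp⟩
    refine ⟨⟨α, hα⟩, y, subset_generated _ ⟨⟨y, hy⟩, hle rfl, rfl⟩, ?_⟩
    rwa [dist_eq_norm] at hxy
  · intro C hC hchain hcard
    obtain ⟨s, -, hs⟩ := hsup C hC hchain hcard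
    exact ⟨s, hs⟩
  · intro α
    have := (isSeparable_generated
      ((Cardinal.le_aleph0_iff_set_countable.1 α.1.2).image Subtype.val)).separableSpace
    exact @density_le_of_separableSpace _ _ this
  · exact fun α => Subtype.val_injective
  · intro B hB hchain hcard α hα
    have hBne := hB.to_subtype
    obtain ⟨s, hs, hlub⟩ := hsup B hB hchain hcard
    obtain rfl := hα.unique hlub
    refine isLimit_restrict_subalgebraSystem _ _ B hchain α _ fun x hx ε hε => ?_
    rw [hs] at hx
    exact exists_mem_generatedBy_of_directed (s := fun β : B => β.1.1.1) hchain.directed hx hε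

theorem hasDecomposition_of_isSaturated (P : ∀ (Z : Type u) [CStarAlgebra Z], Prop)
    (W : X → X → Set X) (hW : ∀ a b, (W a b).Countable)
    (hP : ∀ S : CStarSubalgebra X, IsSaturated W S.toStarSubalgebra → P S.carrier)
    {Y : Set X} (hY : Dense Y) : HasDecomposition P X Y := by
  obtain ⟨H, hH, hsat⟩ := exists_closedSets_isSaturated W hW hY
  exact ⟨closedSets H, isCofinal_closedSets H hH, isTauClosed_closedSets H, _, _,
    isCStarTauSystem_generatedBy hY H hH, fun α =>
    ⟨(isSeparable_generated
      ((Cardinal.le_aleph0_iff_set_countable.1 α.1.2).image Subtype.val)).separableSpace,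
      hP _ (hsat α.1 α.2)⟩⟩

/-! ### Elements of the limit of a system of subalgebras -/

/-- By uniqueness in the universal property the inclusions into the closure of the union show that
the union is dense; as countable increasing sequences of indices have upper bounds, it is already
closed. -/
theorem DirectSystem.IsCStarTauSystem.exists_mem {A : Type u} [PartialOrder A]
    {S : A → CStarSubalgebra X}
    {hS : ∀ α β, α ≤ β → (S α).toStarSubalgebra ≤ (S β).toStarSubalgebra}
    (h : (subalgebraSystem S hS).IsCStarTauSystem ℵ₀ X
      fun α => (S α).toStarSubalgebra.subtype) (x : X) :
    ∃ α, x ∈ (S α).toStarSubalgebra := by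
  have := h.nonempty
  have := h.directed
  have hdir : Directed (· ≤ ·) fun α => (S α).toStarSubalgebra :=
    directed_of_isDirected_le fun α β => hS α β
  obtain ⟨T, hT_eq⟩ : ∃ T : CStarSubalgebra X,
      T.toStarSubalgebra = (⨆ α, (S α).toStarSubalgebra).topologicalClosure :=
    ⟨⟨_, StarSubalgebra.isClosed_topologicalClosure _⟩, rfl⟩
  have hT : ∀ α, (S α).toStarSubalgebra ≤ T.toStarSubalgebra := fun α => hT_eq ▸
    (le_iSup (fun α => (S α).toStarSubalgebra) α).trans (StarSubalgebra.le_topologicalClosure _)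
  obtain ⟨g, hg, -⟩ := h.isLimit.universal T.carrier
    (fun α => StarSubalgebra.inclusion (hT α)) fun _ => rfl
  have hid : T.toStarSubalgebra.subtype.comp g = StarAlgHom.id ℂ X := by
    refine (h.isLimit.universal X (fun α => (S α).toStarSubalgebra.subtype)
      fun _ => rfl).unique (fun α => ?_) fun α => rfl
    ext y
    exact congrArg Subtype.val (DFunLike.congr_fun (hg α) y)
  have hx : x ∈ closure ((⨆ α, (S α).toStarSubalgebra : StarSubalgebra ℂ X) : Set X) := by
    have hgx : ((g x : T.carrier) : X) = x := DFunLike.congr_fun hid x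
    have hxT : x ∈ T.toStarSubalgebra := hgx ▸ (g x).2
    rwa [hT_eq] at hxT
  rw [StarSubalgebra.coe_iSup_of_directed hdir] at hx
  obtain ⟨v, hv, hlim⟩ := mem_closure_iff_seq_limit.1 hx
  choose a ha using fun k => Set.mem_iUnion.1 (hv k)
  choose ub hub₁ hub₂ using fun α β : A => exists_ge_ge α β
  let b : ℕ → A := fun k => Nat.rec (a 0) (fun k β => ub β (a (k + 1))) k
  have b_mono : Monotone b := monotone_nat_of_le_succ fun k => hub₁ _ _
  have hab : ∀ k, a k ≤ b k
    | 0 => le_rfl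
    | k + 1 => hub₂ _ _
  obtain ⟨s, hs⟩ := h.complete (Set.range b) (Set.range_nonempty b) b_mono.isChain_range
    (Set.countable_range b).le_aleph0
  exact ⟨s, (S s).isClosed.mem_of_tendsto hlim (Filter.Eventually.of_forall fun k =>
    hS _ _ ((hab k).trans (hs.1 ⟨k, rfl⟩)) (ha k))⟩

theorem HasDecomposition.exists_mem_mem {P : ∀ (Z : Type u) [CStarAlgebra Z], Prop} {Y : Set X}
    (h : HasDecomposition P X Y) (x y : X) : ∃ S : CStarSubalgebra X,
      x ∈ S.toStarSubalgebra ∧ y ∈ S.toStarSubalgebra ∧ P S.carrier := by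
  obtain ⟨A, -, -, S, hS, hsys, hP⟩ := h
  have := hsys.directed
  obtain ⟨α, hα⟩ := hsys.exists_mem x
  obtain ⟨β, hβ⟩ := hsys.exists_mem y
  obtain ⟨γ, hαγ, hβγ⟩ := exists_ge_ge α β
  exact ⟨S γ, hS _ _ hαγ hα, hS _ _ hβγ hβ, (hP γ).2⟩

/-! ### Passing from subalgebras to the algebra -/

theorem isAP_of_forall_mem {n : ℕ}
    (h : ∀ x : X, ∃ S : CStarSubalgebra X, x ∈ S.toStarSubalgebra ∧ IsAP n S.carrier) :
    IsAP n X := by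
  intro a ha ε hε
  obtain ⟨S, haS, hS⟩ := h a
  obtain ⟨b, hb, hab⟩ := hS ⟨a, haS⟩ ha ε hε
  exact ⟨b, hb, hab⟩

theorem isHP_of_forall_mem_mem {n : ℕ} (h : ∀ x y : X, ∃ S : CStarSubalgebra X,
    x ∈ S.toStarSubalgebra ∧ y ∈ S.toStarSubalgebra ∧ IsHP n S.carrier) : IsHP n X := by
  rintro _ ⟨v, rfl⟩ ha ε hε
  obtain ⟨S, hv, hv', hS⟩ := h v (v⁻¹ : Xˣ)
  have hunit : IsUnit (⟨v, hv⟩ : S.carrier) :=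
    ⟨⟨⟨v, hv⟩, ⟨_, hv'⟩, Subtype.ext v.mul_inv, Subtype.ext v.inv_mul⟩, rfl⟩
  obtain ⟨b, hb, hab⟩ := hS ⟨v, hv⟩ hunit ha ε hε
  exact ⟨b, hb, hab⟩

theorem boundedRankLE_one_of_forall_mem_mem {K : ℝ} (h : ∀ x y : X, ∃ S : CStarSubalgebra X,
    x ∈ S.toStarSubalgebra ∧ y ∈ S.toStarSubalgebra ∧ BoundedRankLE K 1 S.carrier) :
    BoundedRankLE K 1 X := by
  intro K' hK' hK'K y hy δ hδ
  obtain ⟨S, h0, h1, hS⟩ := h (y 0) (y 1)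
  have hyS : ∀ k, y k ∈ S.toStarSubalgebra := Fin.forall_fin_two.2 ⟨h0, h1⟩
  obtain ⟨z, hz, hyz, v, hv, hvK⟩ := hS K' hK' hK'K (fun k => ⟨y k, hyS k⟩)
    (fun k => Subtype.ext (hy k)) δ hδ
  refine ⟨fun k => z k, fun k => congrArg Subtype.val (hz k), hyz,
    Units.map (S.toStarSubalgebra.subtype : S.carrier →* X) v, ?_, hvK⟩
  have := congrArg S.toStarSubalgebra.subtype hv
  rw [map_sum] at this
  exact this

/-! ### Witnesses for membership in the classes -/

/-- The rescaling of `a` into the closed unit ball. -/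
noncomputable def rescale (a : X) : X := (max 1 ‖a‖)⁻¹ • a

theorem norm_rescale_le (a : X) : ‖rescale a‖ ≤ 1 := by
  have : 0 < max 1 ‖a‖ := lt_max_of_lt_left one_pos
  rw [rescale, norm_smul, norm_inv, Real.norm_of_nonneg this.le, inv_mul_le_one₀ this]
  exact le_max_right _ _

theorem norm_sub_rescale_le (a : X) : ‖a - rescale a‖ ≤ max 1 ‖a‖ - 1 := by
  have h : 0 < max 1 ‖a‖ := lt_max_of_lt_left one_pos
  have : a - rescale a = (max 1 ‖a‖ - 1) • rescale a := by
    rw [sub_smul, one_smul, rescale, smul_inv_smul₀ h.ne']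
  rw [this, norm_smul, Real.norm_of_nonneg (sub_nonneg.2 (le_max_left _ _))]
  exact mul_le_of_le_one_right (sub_nonneg.2 (le_max_left _ _)) (norm_rescale_le a)

theorem isUnit_rescale {a : X} (ha : IsUnit a) : IsUnit (rescale a) := by
  have h : 0 < max 1 ‖a‖ := lt_max_of_lt_left one_pos
  have := ha.smul (Units.mk0 _ (inv_pos.2 h).ne')
  exact this

theorem norm_sub_rescale_lt {x a : X} (hx : ‖x‖ ≤ 1) {ε : ℝ} (hxa : ‖x - a‖ < ε) :
    ‖x - rescale a‖ < 2 * ε := by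
  have h1 : ‖a‖ ≤ ‖x‖ + ‖x - a‖ := by
    simpa using norm_sub_le x (x - a)
  have h2 : max 1 ‖a‖ ≤ 1 + ‖x - a‖ := max_le (by linarith [norm_nonneg (x - a)]) (by linarith)
  linarith [norm_sub_le_norm_sub_add_norm_sub x a (rescale a), norm_sub_rescale_le a]

/-- A common witness table for `AP(n)` and `HP(n)`: approximate roots of the elements of the open
set `U`, which is the whole algebra or the set of invertible elements. -/
theorem exists_root_witnesses {n : ℕ} (U : Set X) (hU : IsOpen U)
    (hUs : ∀ a ∈ U, rescale a ∈ U)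
    (h : ∀ a ∈ U, ‖a‖ ≤ 1 → ∀ ε : ℝ, 0 < ε → ∃ b : X, ‖b‖ ≤ 1 ∧ ‖a - b ^ n‖ < ε) :
    ∃ W : X → X → Set X, (∀ a b, (W a b).Countable) ∧
      ∀ S : CStarSubalgebra X, IsSaturated W S.toStarSubalgebra →
        ∀ a : S.carrier, (a : X) ∈ U → ‖a‖ ≤ 1 → ∀ ε : ℝ, 0 < ε →
          ∃ b : S.carrier, ‖b‖ ≤ 1 ∧ ‖a - b ^ n‖ < ε := by
  have h' : ∀ (a : X) (k : ℕ), ∃ b : X, a ∈ U →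
      ‖b‖ ≤ 1 ∧ ‖rescale a - b ^ n‖ < 1 / ((k : ℝ) + 1) := by
    intro a k
    by_cases ha : a ∈ U
    · obtain ⟨b, hb⟩ := h _ (hUs a ha) (norm_rescale_le a) _ (Nat.one_div_pos_of_nat (n := k))
      exact ⟨b, fun _ => hb⟩
    · exact ⟨0, fun h => absurd h ha⟩
  choose r hr using h'
  refine ⟨fun a _ => Set.range (r a), fun a _ => Set.countable_range _, ?_⟩
  intro S hS a haU ha ε hε
  obtain ⟨k, hk⟩ := exists_nat_one_div_lt (half_pos hε)
  obtain ⟨η, hη, hball⟩ := Metric.isOpen_iff.1 hU a haU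
  obtain ⟨d, _, had, -, hd⟩ := hS a a.2 a a.2 (min η (ε / 4)) (lt_min hη (by linarith))
  have hdU : d ∈ U := hball (by
    rw [Metric.mem_ball, dist_comm, dist_eq_norm]
    exact had.trans_le (min_le_left _ _))
  refine ⟨⟨r d k, hd ⟨k, rfl⟩⟩, (hr d k hdU).1, ?_⟩
  change ‖(a : X) - r d k ^ n‖ < ε
  have h1 := norm_sub_rescale_lt (x := (a : X)) ha (had.trans_le (min_le_right _ _))
  linarith [norm_sub_le_norm_sub_add_norm_sub (a : X) (rescale d) (r d k ^ n), (hr d k hdU).2]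

theorem exists_isAP_witnesses {n : ℕ} (h : IsAP n X) :
    ∃ W : X → X → Set X, (∀ a b, (W a b).Countable) ∧
      ∀ S : CStarSubalgebra X, IsSaturated W S.toStarSubalgebra → IsAP n S.carrier := by
  obtain ⟨W, hW, hS⟩ := exists_root_witnesses Set.univ isOpen_univ (fun _ _ => trivial)
    fun a _ => h a
  exact ⟨W, hW, fun S hSW a => hS S hSW a trivial⟩

theorem exists_isHP_witnesses {n : ℕ} (h : IsHP n X) :
    ∃ W : X → X → Set X, (∀ a b, (W a b).Countable) ∧
      ∀ S : CStarSubalgebra X, IsSaturated W S.toStarSubalgebra → IsHP n S.carrier := by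
  obtain ⟨W, hW, hS⟩ := exists_root_witnesses {a : X | IsUnit a} Units.isOpen
    (fun _ => isUnit_rescale) h
  exact ⟨W, hW, fun S hSW a ha => hS S hSW a (ha.map S.toStarSubalgebra.subtype)⟩

/-- For `d = 1` the witnesses are the perturbations of pairs of real parts and the inverses of the
sums of their squares, for rational constants and rational tolerances. The requirement for every
`K' < K` leaves room for the errors of approximation. -/
theorem exists_boundedRankLE_one_witnesses {K : ℝ} (h : BoundedRankLE K 1 X) :
    ∃ W : X → X → Set X, (∀ a b, (W a b).Countable) ∧
      ∀ S : CStarSubalgebra X, IsSaturated W S.toStarSubalgebra →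
        BoundedRankLE K 1 S.carrier := by
  have h' : ∀ (a b : X) (p : ℚ × ℚ), ∃ (z : Fin (1 + 1) → X) (v : Xˣ),
      0 < (p.1 : ℝ) → (p.1 : ℝ) < K → 0 < (p.2 : ℝ) →
        (∀ k, IsSelfAdjoint (z k)) ∧
        (∀ k, ‖((realPart (![a, b] k) : selfAdjoint X) : X) - z k‖ ≤ p.2) ∧
        (v : X) = ∑ k, z k ^ 2 ∧ ‖((v⁻¹ : Xˣ) : X)‖ ≤ 1 / (p.1 * (p.2 : ℝ) ^ 2) := by
    intro a b p
    by_cases hp : 0 < (p.1 : ℝ) ∧ (p.1 : ℝ) < K ∧ 0 < (p.2 : ℝ)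
    · obtain ⟨z, h1, h2, v, h3, h4⟩ := h p.1 hp.1 hp.2.1
        (fun k => ((realPart (![a, b] k) : selfAdjoint X) : X)) (fun k => (realPart _).2)
        p.2 hp.2.2
      exact ⟨z, v, fun _ _ _ => ⟨h1, h2, h3, h4⟩⟩
    · exact ⟨0, 1, fun h1 h2 h3 => absurd ⟨h1, h2, h3⟩ hp⟩
  choose z v hzv using h'
  refine ⟨fun a b => ⋃ p, (Set.range (z a b p) ∪ {((v a b p)⁻¹ : Xˣ).val}), fun a b =>
    Set.countable_iUnion fun p => (Set.countable_range _).union (Set.countable_singleton _), ?_⟩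
  intro S hS K' hK' hK'K y hy δ hδ
  obtain ⟨q, hK'q, hqK⟩ := exists_rat_btwn hK'K
  have hq : (0 : ℝ) < q := hK'.trans hK'q
  -- The tolerance `r` is slightly smaller than `δ`, with `K' δ² ≤ q r²`.
  have hlt : δ * Real.sqrt (K' / q) < δ := by
    refine mul_lt_of_lt_one_right hδ ?_
    rw [Real.sqrt_lt' one_pos, one_pow, div_lt_one hq]
    exact hK'q
  obtain ⟨r, hr, hrδ⟩ := exists_rat_btwn hlt
  have hr0 : (0 : ℝ) < r := (mul_pos hδ (Real.sqrt_pos.2 (div_pos hK' hq))).trans hr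
  have hqr : K' * δ ^ 2 ≤ q * (r : ℝ) ^ 2 := by
    have h1 : (δ * Real.sqrt (K' / q)) ^ 2 ≤ (r : ℝ) ^ 2 := by gcongr
    rw [mul_pow, Real.sq_sqrt (div_pos hK' hq).le] at h1
    calc K' * δ ^ 2 = q * (δ ^ 2 * (K' / q)) := by field_simp
      _ ≤ q * (r : ℝ) ^ 2 := by gcongr
  obtain ⟨a, b, ha, hb, hab⟩ := hS (y 0) (y 0).2 (y 1) (y 1).2 (δ - r) (sub_pos.2 hrδ)
  obtain ⟨hz, hyz, hv, hvn⟩ := hzv a b (q, r) hq hqK hr0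
  have hzS : ∀ k, z a b (q, r) k ∈ S.toStarSubalgebra := fun k =>
    hab (Set.mem_iUnion.2 ⟨(q, r), Or.inl ⟨k, rfl⟩⟩)
  have hvS : ((v a b (q, r))⁻¹ : Xˣ).val ∈ S.toStarSubalgebra :=
    hab (Set.mem_iUnion.2 ⟨(q, r), Or.inr rfl⟩)
  -- Taking real parts is a contraction that fixes self-adjoint elements.
  have hre : ∀ (x : S.carrier) (c : X), IsSelfAdjoint x → ‖(x : X) - c‖ < δ - r →
      ‖(x : X) - ((realPart c : selfAdjoint X) : X)‖ ≤ δ - r := by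
    intro x c hx hxc
    have hx' : IsSelfAdjoint (x : X) := congrArg Subtype.val hx
    have : (x : X) - ((realPart c : selfAdjoint X) : X) =
        ((realPart ((x : X) - c) : selfAdjoint X) : X) := by
      rw [map_sub, AddSubgroupClass.coe_sub, hx'.coe_realPart]
    rw [this]
    exact (realPart.norm_le _).trans hxc.le
  have hyre : ∀ k, ‖(y k : X) - ((realPart (![a, b] k) : selfAdjoint X) : X)‖ ≤ δ - r :=
    Fin.forall_fin_two.2 ⟨hre _ _ (hy 0) ha, hre _ _ (hy 1) hb⟩
  have hsum : ((∑ k, (⟨z a b (q, r) k, hzS k⟩ : S.carrier) ^ 2 : S.carrier) : X) =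
      v a b (q, r) := by
    rw [hv]
    exact map_sum S.toStarSubalgebra.subtype
      (fun k => (⟨z a b (q, r) k, hzS k⟩ : S.carrier) ^ 2) Finset.univ
  refine ⟨fun k => ⟨z a b (q, r) k, hzS k⟩, fun k => Subtype.ext (hz k), fun k => ?_,
    ⟨∑ k, (⟨z a b (q, r) k, hzS k⟩ : S.carrier) ^ 2, ⟨_, hvS⟩, Subtype.ext ?_, Subtype.ext ?_⟩,
    rfl, ?_⟩
  · change ‖(y k : X) - z a b (q, r) k‖ ≤ δ
    linarith [norm_sub_le_norm_sub_add_norm_sub (y k : X)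
      ((realPart (![a, b] k) : selfAdjoint X) : X) (z a b (q, r) k), hyz k, hyre k]
  · rw [MulMemClass.coe_mul, hsum]
    exact Units.mul_inv _
  · rw [MulMemClass.coe_mul, hsum]
    exact Units.inv_mul _
  · exact hvn.trans (one_div_le_one_div_of_le (by positivity) hqr)

theorem RootClass.exists_mem_witnesses (𝒦 : RootClass) {K : ℝ} {n : ℕ} (h : 𝒦.Mem K n X) :
    ∃ W : X → X → Set X, (∀ a b, (W a b).Countable) ∧
      ∀ S : CStarSubalgebra X, IsSaturated W S.toStarSubalgebra → 𝒦.Mem K n S.carrier := by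
  match 𝒦 with
  | .AP => exact exists_isAP_witnesses h
  | .HP => exact exists_isHP_witnesses h
  | .AP₁ =>
    obtain ⟨V, hV, hVS⟩ := exists_isAP_witnesses h.1
    obtain ⟨W, hW, hWS⟩ := exists_boundedRankLE_one_witnesses h.2
    exact ⟨fun a b => V a b ∪ W a b, fun a b => (hV a b).union (hW a b), fun S hS =>
      ⟨hVS S (hS.mono fun _ _ => Set.subset_union_left),
        hWS S (hS.mono fun _ _ => Set.subset_union_right)⟩⟩

theorem RootClass.mem_of_forall_mem_mem (𝒦 : RootClass) {K : ℝ} {n : ℕ}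
    (h : ∀ x y : X, ∃ S : CStarSubalgebra X,
      x ∈ S.toStarSubalgebra ∧ y ∈ S.toStarSubalgebra ∧ 𝒦.Mem K n S.carrier) :
    𝒦.Mem K n X := by
  match 𝒦 with
  | .AP => exact isAP_of_forall_mem fun x => let ⟨S, hx, _, hS⟩ := h x x; ⟨S, hx, hS⟩
  | .HP => exact isHP_of_forall_mem_mem h
  | .AP₁ =>
    exact ⟨isAP_of_forall_mem fun x => let ⟨S, hx, _, hS⟩ := h x x; ⟨S, hx, hS.1⟩,
      boundedRankLE_one_of_forall_mem_mem fun x y =>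
        let ⟨S, hx, hy, hS⟩ := h x y; ⟨S, hx, hy, hS.2⟩⟩

end RootProperty

theorem proposition3p4 (𝒦 : RootProperty.RootClass) (K : ℝ) (hK : 0 < K) (n : ℕ) (hn : 1 ≤ n)
    (X : Type u) [CStarAlgebra X] :
    List.TFAE [
      𝒦.Mem K n X,
      ∃ Y : Set X, Dense Y ∧ Cardinal.mk Y = RootProperty.density X ∧
        RootProperty.HasDecomposition (fun Z _ => 𝒦.Mem K n Z) X Y,
      ∀ Y : Set X, Dense Y → Cardinal.mk Y = RootProperty.density X →
        RootProperty.HasDecomposition (fun Z _ => 𝒦.Mem K n Z) X Y] := by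
  tfae_have 1 → 3 := fun h Y hY _ =>
    let ⟨W, hW, hS⟩ := 𝒦.exists_mem_witnesses h
    RootProperty.hasDecomposition_of_isSaturated _ W hW hS hY
  tfae_have 3 → 2 := fun h =>
    let ⟨Y, hY, hcard⟩ := RootProperty.exists_dense_mk_eq_density X
    ⟨Y, hY, hcard, h Y hY hcard⟩
  tfae_have 2 → 1 := fun ⟨_, _, _, h⟩ => 𝒦.mem_of_forall_mem_mem h.exists_mem_mem
  tfae_finish
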